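/- Let $S$ and $A$ be finite sets and $H \ge 0$. An MDP $M$ on $(S,A)$ is given by an initial distribution $\mu$ on $S$ and transition probabilities $P(s'|s,a)$. A policy $\pi$ generates the trajectory $\tau=(s_1,a_1,\dots,s_H,a_H,s_{H+1})$ with probability $P^{M}_{\pi}(\tau)=\mu(s_1)\pi(a_1|s_1)P(s_2|s_1,a_1)\cdots\pi(a_H|s_H)P(s_{H+1}|s_H,a_H)$. Call $M$ a discrete DAG MDP (of horizon $H$) if for every $s\in S$ there is a unique $t\in\{1,\dots,H+1\}$ with $\max_{g:S\to A}P^M_g(s_t=s)>0$. The only reward is the deterministic terminal reward $R(s_{H+1})$, with $R:S\to\mathbb R$ known, and there is no discounting; so the value of $\pi$ in $M$ is $v^{\pi}_M=\mathbb E^M_\pi[R(s_{H+1})]$. Let $M$ be a discrete DAG MDP, and let $\pi_0$ (behavior policy) and $\pi_1$ (target policy) be stationary stochastic policies. Let $f$ be an unbiased estimator of the value of $\pi_1$ from one trajectory generated by $\pi_0$, that is, a real function of trajectories with $\mathbb E^{M'}_{\pi_0}[f(\tau)]=v^{\pi_1}_{M'}$ for every discrete DAG MDP $M'$ that has the same transition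 graph as $M$ (the same initial states and the same transitions have positive probability in $M'$ as in $M$); in particular, this covers every estimator that is unbiased for all discrete DAG MDPs on $(S,A)$. Then $$\operatorname{Var}\big(f(\tau)\big)\;\ge\;\sum_{t=1}^{H+1}\mathbb E\left[\frac{P_1(s_{t-1},a_{t-1})^2}{P_0(s_{t-1},a_{t-1})^2}\,\operatorname{Var}_t\big(V(s_t)\big)\right].$$ Here expectations and variances are those of the trajectory generated by $\pi_0$ in $M$. For $j=0,1$ and $t\ge 2$, $P_j(s_{t-1},a_{t-1})$ is the marginal probability of the state-action pair $(s_{t-1},a_{t-1})$ at time $t-1$ under $\pi_j$ in $M$; for $t=1$ the state-action pair is empty and the ratio is $1$. $\operatorname{Var}_t$ is the conditional variance given $s_1,a_1,\dots,s_{t-1},a_{t-1}$, and $V(s_t)$ is the value of $\pi_1$ in $M$ when started at $s_t$ with $H+1-t$ steps remaining (so $V(s_{H+1})=R(s_{H+1})$). -/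

import Mathlib

noncomputable section

namespace DagMDP

/-! Elementary probability on a finite sample space with mass function `p`. -/

section FiniteProbability

variable {Ω : Type*} [Fintype Ω]

/-- Probability of the event `C`. -/
def prob (p : Ω → ℝ) (C : Ω → Prop) : ℝ :=
  open Classical in ∑ ω with C ω, p ω

/-- Expectation of `X`. -/
def expect (p : Ω → ℝ) (X : Ω → ℝ) : ℝ := ∑ ω, p ω * X ω

/-- Variance of `X`. -/
def variance (p : Ω → ℝ) (X : Ω → ℝ) : ℝ := expect p fun ω => (X ω - expect p X) ^ 2

/-- Expectation of `X` conditioned on the event `C` (of positive probability). -/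
def condExpect (p : Ω → ℝ) (C : Ω → Prop) (X : Ω → ℝ) : ℝ :=
  (open Classical in ∑ ω with C ω, p ω * X ω) / prob p C

/-- Variance of `X` conditioned on the event `C` (of positive probability). -/
def condVariance (p : Ω → ℝ) (C : Ω → Prop) (X : Ω → ℝ) : ℝ :=
  condExpect p C fun ω => (X ω - condExpect p C X) ^ 2

end FiniteProbability

/-- The unknown parameters of a finite MDP: an initial distribution `μ` and transition
probabilities, `P s a s'` being the probability of moving to `s'` after action `a` in `s`. -/
structure MDP (S A : Type*) [Fintype S] where
  /-- initial state distribution -/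
  μ : S → ℝ
  /-- transition function -/
  P : S → A → S → ℝ
  μ_mem : μ ∈ stdSimplex ℝ S
  P_mem : ∀ s a, P s a ∈ stdSimplex ℝ S

/-- A stationary stochastic policy; `prob s a` is the probability of action `a` in state `s`. -/
structure Policy (S A : Type*) [Fintype A] where
  /-- action probabilities -/
  prob : S → A → ℝ
  prob_mem : ∀ s, prob s ∈ stdSimplex ℝ A

/-- A trajectory `(s₁, a₁, …, s_H, a_H, s_{H+1})`. Indices start at `0` here: the state `s_t` is
`τ.1 (t - 1)` and the action `a_t` is `τ.2 (t - 1)`. -/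
abbrev Traj (S A : Type*) (H : ℕ) : Type _ := (Fin (H + 1) → S) × (Fin H → A)

variable {S A : Type*} [Fintype S] [Fintype A]

/-- The policy that chooses the action `g s` in state `s`. -/
def Policy.ofFun (g : S → A) : Policy S A where
  prob s := open Classical in Pi.single (g s) 1
  prob_mem s := by
    classical
    exact single_mem_stdSimplex ℝ (g s)

/-- The MDP `M` started at the state `s` instead of at a random state. -/
def MDP.startAt (M : MDP S A) (s : S) : MDP S A where
  μ := open Classical in Pi.single s 1
  P := M.P
  μ_mem := by
    classical
    exact single_mem_stdSimplex ℝ s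
  P_mem := M.P_mem

/-- The law of the length-`H` trajectory generated by the policy `π`:
`μ(s₁) π(a₁|s₁) P(s₂|s₁,a₁) ⋯ π(a_H|s_H) P(s_{H+1}|s_H,a_H)`. -/
def MDP.law (M : MDP S A) (π : Policy S A) {H : ℕ} (τ : Traj S A H) : ℝ :=
  M.μ (τ.1 0) *
    ∏ i : Fin H, π.prob (τ.1 i.castSucc) (τ.2 i) * M.P (τ.1 i.castSucc) (τ.2 i) (τ.1 i.succ)

/-- The value of `π` over `H` steps: the expected terminal reward `R(s_{H+1})` (undiscounted). -/
def MDP.value (M : MDP S A) (π : Policy S A) (R : S → ℝ) (H : ℕ) : ℝ :=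
  expect (M.law π) fun τ : Traj S A H => R (τ.1 (Fin.last H))

/-- The value of `π` at the state `s` when `h` steps remain. -/
def MDP.stateValue (M : MDP S A) (π : Policy S A) (R : S → ℝ) (h : ℕ) (s : S) : ℝ :=
  (M.startAt s).value π R h

/-- Discrete (layered) DAG MDP of horizon `H`: for every state `s` there is exactly one time step
at which `s` is visited with positive probability under some policy `g : S → A`. -/
def MDP.IsDAG (M : MDP S A) (H : ℕ) : Prop :=
  ∀ s : S, ∃! t : Fin (H + 1), ∃ g : S → A,
    0 < prob (M.law (Policy.ofFun g)) fun τ : Traj S A H => τ.1 t = s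

/-- Two MDPs have the same transition graph if the same initial states and the same transitions
have positive probability. -/
def MDP.SameGraph (M M' : MDP S A) : Prop :=
  (∀ s, 0 < M.μ s ↔ 0 < M'.μ s) ∧ ∀ s a s', 0 < M.P s a s' ↔ 0 < M'.P s a s'

/-- `f` is an unbiased estimator of the value of `π₁` from a trajectory generated by `π₀`, for the
family of discrete DAG MDPs that have the transition graph of `M`. The reward function, the two
policies and the graph are known; the initial and transition probabilities are not. -/
def IsUnbiased (M : MDP S A) (π₀ π₁ : Policy S A) (R : S → ℝ) {H : ℕ} (f : Traj S A H → ℝ) :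
    Prop :=
  ∀ M' : MDP S A, M'.IsDAG H → M.SameGraph M' → expect (M'.law π₀) f = M'.value π₁ R H

/-- The marginal probability that action `a` is taken in state `s` at time step `i`. -/
def MDP.occupancy (M : MDP S A) (π : Policy S A) {H : ℕ} (i : Fin H) (s : S) (a : A) : ℝ :=
  prob (M.law π) fun τ : Traj S A H => τ.1 i.castSucc = s ∧ τ.2 i = a

/-- `P₁(s_k, a_k) / P₀(s_k, a_k)`, where `(s_k, a_k)` is the `k`-th state-action pair of `τ`. For
`k = 0` there is a single (empty) state-action pair, and the ratio is `1`. -/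
def MDP.occupancyRatio (M : MDP S A) (π₀ π₁ : Policy S A) {H : ℕ} (k : Fin (H + 1))
    (τ : Traj S A H) : ℝ :=
  Fin.cases 1
    (fun i : Fin H => M.occupancy π₁ i (τ.1 i.castSucc) (τ.2 i) /
      M.occupancy π₀ i (τ.1 i.castSucc) (τ.2 i)) k

/-- `τ'` has the same first `k` state-action pairs `s₁, a₁, …, s_k, a_k` as `τ`. -/
def SameHistory {H : ℕ} (k : Fin (H + 1)) (τ τ' : Traj S A H) : Prop :=
  ∀ i : Fin H, (i : ℕ) < k → τ'.1 i.castSucc = τ.1 i.castSucc ∧ τ'.2 i = τ.2 i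

/-- The conditional variance, under `π₀`, of `V(s_{k+1})` given `s₁, a₁, …, s_k, a_k`, where
`V(s_{k+1})` is the value of `π₁` at `s_{k+1}`, with `H - k` steps remaining. -/
def MDP.condVarValue (M : MDP S A) (π₀ π₁ : Policy S A) (R : S → ℝ) {H : ℕ} (k : Fin (H + 1))
    (τ : Traj S A H) : ℝ :=
  condVariance (M.law π₀) (SameHistory k τ) fun τ' => M.stateValue π₁ R (H - k) (τ'.1 k)

end DagMDP

end

/-! This is a Cramér–Rao argument with a well-chosen direction. Replacing `μ` and `P` by `μ (1 + ε
d₀)` and `P (1 + ε d)`, with `d₀` and `d` of mean zero, keeps the transition graph for small `ε`, so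
`f` stays unbiased. Differentiating at `ε = 0` gives E₀[f Y] = E₁[R Y], where the score `Y` is the
sum of `d₀` and `d` along the trajectory (`expect_mul_score_eq`).

Choose the direction so that `Y` is the sum of the martingale differences (P₁/P₀)(V(s_t) - E_t
V(s_t)). The parameters are stationary while the ratios depend on time; the DAG property reconciles
the two, since a state-action pair can occur at one time only (`score_eq_sum_increment`). The tower
property and P₁ · (P₁/P₀) = P₀ · (P₁/P₀)² give E₁[R Y] = E₀[Y²] (`expect_reward_mul_increment`).
Hence Var f ≥ E₀[Y²] (`expect_sq_le_variance`), and orthogonality of the differences splits E₀[Y²]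
into the terms of the bound. -/

namespace DagMDP

/-! ### Finite probability -/

section FiniteProbability

variable {Ω : Type*} [Fintype Ω]

theorem expect_sum {ι : Type*} (s : Finset ι) (p : Ω → ℝ) (X : ι → Ω → ℝ) :
    expect p (fun ω => ∑ i ∈ s, X i ω) = ∑ i ∈ s, expect p (X i) := by
  simp only [expect, Finset.mul_sum]
  exact Finset.sum_comm

theorem expect_congr {p X Y : Ω → ℝ} (h : ∀ ω, p ω ≠ 0 → X ω = Y ω) :
    expect p X = expect p Y := by
  refine Finset.sum_congr rfl fun ω _ => ?_
  by_cases hω : p ω = 0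
  · simp [hω]
  · rw [h ω hω]

open Classical in
theorem prob_eq_expect (p : Ω → ℝ) (C : Ω → Prop) :
    prob p C = expect p fun ω => if C ω then 1 else 0 := by
  simp [prob, expect, Finset.sum_filter]

theorem prob_pos_iff {p : Ω → ℝ} (hp : ∀ ω, 0 ≤ p ω) (C : Ω → Prop) :
    0 < prob p C ↔ ∃ ω, C ω ∧ 0 < p ω := by
  classical
  unfold prob
  rw [Finset.sum_pos_iff_of_nonneg fun ω _ => hp ω]
  simp

open Classical in
theorem condExpect_eq_of_expect_eq {p : Ω → ℝ} {C : Ω → Prop} {X : Ω → ℝ} {c : ℝ}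
    (hC : prob p C ≠ 0)
    (h : expect p (fun ω => if C ω then X ω else 0) = expect p (fun ω => if C ω then c else 0)) :
    condExpect p C X = c := by
  have h₁ : (∑ ω with C ω, p ω * X ω) = expect p (fun ω => if C ω then X ω else 0) := by
    simp [expect, Finset.sum_filter]
  have h₂ : expect p (fun ω => if C ω then c else 0) = c * prob p C := by
    simp only [expect, prob, Finset.sum_filter, Finset.mul_sum]
    exact Finset.sum_congr rfl fun ω _ => by split_ifs <;> ring
  unfold condExpect
  rw [h₁, h, h₂, mul_div_cancel_right₀ _ hC]

/-- A covariance bound: if `Y` is centred and `E[X Y] = E[Y²]`, then `E[Y²] ≤ Var X`. -/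
theorem expect_sq_le_variance {p X Y : Ω → ℝ} (hp : ∀ ω, 0 ≤ p ω)
    (hY : expect p Y = 0) (hXY : expect p (fun ω => X ω * Y ω) = expect p fun ω => Y ω ^ 2) :
    expect p (fun ω => Y ω ^ 2) ≤ variance p X := by
  -- Expanding this square avoids dividing by E[Y²], so the case E[Y²] = 0 is not special.
  have h : 0 ≤ expect p fun ω => (X ω - expect p X - Y ω) ^ 2 :=
    Finset.sum_nonneg fun ω _ => mul_nonneg (hp ω) (sq_nonneg _)
  have h' : expect p (fun ω => (X ω - expect p X - Y ω) ^ 2) =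
      variance p X - 2 * expect p (fun ω => X ω * Y ω) + 2 * expect p X * expect p Y +
        expect p fun ω => Y ω ^ 2 := by
    unfold variance
    generalize expect p X = m
    simp only [expect, Finset.mul_sum, ← Finset.sum_add_distrib, ← Finset.sum_sub_distrib]
    exact Finset.sum_congr rfl fun ω _ => by ring
  rw [h', hY, hXY] at h
  linarith

end FiniteProbability

/-! ### Extending and truncating trajectories -/

variable {S A : Type*}

/-- Append an action and a state to a trajectory. -/
def Traj.snoc {n : ℕ} (σ : Traj S A n) (a : A) (s : S) : Traj S A (n + 1) :=
  (Fin.snoc (α := fun _ => S) σ.1 s, Fin.snoc (α := fun _ => A) σ.2 a)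

/-- The first `k` steps of a trajectory. -/
def Traj.trunc {k H : ℕ} (h : k ≤ H) (τ : Traj S A H) : Traj S A k :=
  (fun i => τ.1 (Fin.castLE (Nat.succ_le_succ h) i), fun i => τ.2 (Fin.castLE h i))

theorem Traj.trunc_self {n : ℕ} (τ : Traj S A n) : Traj.trunc le_rfl τ = τ := rfl

@[simp] theorem Traj.snoc_last {n : ℕ} (σ : Traj S A n) (a : A) (s : S) :
    (σ.snoc a s).1 (Fin.last (n + 1)) = s := by
  simp [Traj.snoc]

@[simp] theorem Traj.snoc_action_last {n : ℕ} (σ : Traj S A n) (a : A) (s : S) :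
    (σ.snoc a s).2 (Fin.last n) = a := by
  simp [Traj.snoc]

@[simp] theorem Traj.snoc_castSucc {n : ℕ} (σ : Traj S A n) (a : A) (s : S) (i : Fin (n + 1)) :
    (σ.snoc a s).1 i.castSucc = σ.1 i := by
  simp [Traj.snoc]

@[simp] theorem Traj.snoc_action_castSucc {n : ℕ} (σ : Traj S A n) (a : A) (s : S) (i : Fin n) :
    (σ.snoc a s).2 i.castSucc = σ.2 i := by
  simp [Traj.snoc]

theorem Traj.trunc_snoc {k n : ℕ} (h : k ≤ n) (σ : Traj S A n) (a : A) (s : S) :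
    Traj.trunc (h.trans n.le_succ) (σ.snoc a s) = Traj.trunc h σ := by
  refine Prod.ext (funext fun i => ?_) (funext fun i => ?_)
  · exact Traj.snoc_castSucc σ a s (Fin.castLE (Nat.succ_le_succ h) i)
  · exact Traj.snoc_action_castSucc σ a s (Fin.castLE h i)

variable [Fintype S] [Fintype A]

theorem Traj.sum_eq_sum_snoc {n : ℕ} (G : Traj S A (n + 1) → ℝ) :
    ∑ τ, G τ = ∑ σ : Traj S A n, ∑ a, ∑ s, G (σ.snoc a s) := by
  rw [Fintype.sum_prod_type, ← (Fin.snocEquiv fun _ : Fin (n + 2) => S).sum_comp,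
    Fintype.sum_prod_type_right, Fintype.sum_prod_type]
  refine Finset.sum_congr rfl fun x _ => ?_
  simp_rw [← (Fin.snocEquiv fun _ : Fin (n + 1) => A).sum_comp, Fintype.sum_prod_type_right]
  rw [Finset.sum_comm]
  refine Finset.sum_congr rfl fun y _ => ?_
  rw [Finset.sum_comm]
  rfl

/-! ### The trajectory law: tower and Markov properties -/

namespace MDP

variable (M : MDP S A) (π : Policy S A)

omit [Fintype A] in
theorem sum_P (s : S) (a : A) : ∑ s', M.P s a s' = 1 := (M.P_mem s a).2

theorem law_nonneg {H : ℕ} (τ : Traj S A H) : 0 ≤ M.law π τ :=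
  mul_nonneg (M.μ_mem.1 _) (Finset.prod_nonneg fun _ _ =>
    mul_nonneg ((π.prob_mem _).1 _) ((M.P_mem _ _).1 _))

theorem law_pos_iff {H : ℕ} (τ : Traj S A H) :
    0 < M.law π τ ↔ 0 < M.μ (τ.1 0) ∧ ∀ i : Fin H,
      0 < π.prob (τ.1 i.castSucc) (τ.2 i) ∧ 0 < M.P (τ.1 i.castSucc) (τ.2 i) (τ.1 i.succ) := by
  have hμ := M.μ_mem.1
  have hP := fun s a => (M.P_mem s a).1
  have hπ := fun s => (π.prob_mem s).1
  simp only [(M.law_nonneg π τ).lt_iff_ne', (hμ _).lt_iff_ne', (hP _ _ _).lt_iff_ne',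
    (hπ _ _).lt_iff_ne']
  simp [law, Finset.prod_ne_zero_iff]

theorem law_snoc {n : ℕ} (σ : Traj S A n) (a : A) (s : S) :
    M.law π (σ.snoc a s) =
      M.law π σ * (π.prob (σ.1 (Fin.last n)) a * M.P (σ.1 (Fin.last n)) a s) := by
  unfold law
  rw [Fin.prod_univ_castSucc]
  simp only [← Fin.castSucc_succ, Fin.succ_last, Traj.snoc_castSucc, Traj.snoc_action_castSucc,
    Traj.snoc_last, Traj.snoc_action_last, ← mul_assoc]
  rw [← Fin.castSucc_zero, Traj.snoc_castSucc]

theorem expect_succ {n : ℕ} (G : Traj S A (n + 1) → ℝ) :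
    expect (M.law π) G = expect (M.law π) fun σ : Traj S A n =>
      ∑ a, π.prob (σ.1 (Fin.last n)) a * ∑ s, M.P (σ.1 (Fin.last n)) a s * G (σ.snoc a s) := by
  unfold expect
  rw [Traj.sum_eq_sum_snoc]
  simp only [law_snoc, Finset.mul_sum, mul_assoc]

theorem expect_zero (G : Traj S A 0 → ℝ) (g : S → ℝ) (h : ∀ τ, G τ = g (τ.1 0)) :
    expect (M.law π) G = ∑ s, M.μ s * g s := by
  unfold expect law
  rw [Fintype.sum_prod_type, ← (Equiv.funUnique (Fin 1) S).symm.sum_comp]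
  refine Finset.sum_congr rfl fun s _ => ?_
  simp [h]

/-- Each step beyond `k` integrates to one, so the law of the first `k` steps does not depend on the
horizon. -/
theorem expect_trunc {k H : ℕ} (hk : k ≤ H) (F : Traj S A k → ℝ) :
    expect (M.law π) (fun τ : Traj S A H => F (τ.trunc hk)) = expect (M.law π) F := by
  induction H, hk using Nat.le_induction with
  | base => rfl
  | succ n hn ih =>
    rw [expect_succ, ← ih]
    simp only [Traj.trunc_snoc hn, ← Finset.sum_mul, M.sum_P, one_mul, (π.prob_mem _).2]

theorem expect_initial {H : ℕ} (g : S → ℝ) :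
    expect (M.law π) (fun τ : Traj S A H => g (τ.1 0)) = ∑ s, M.μ s * g s := by
  rw [← M.expect_zero π (fun τ => g (τ.1 0)) g fun _ => rfl]
  exact M.expect_trunc π H.zero_le fun σ : Traj S A 0 => g (σ.1 0)

theorem sum_law {H : ℕ} : ∑ τ : Traj S A H, M.law π τ = 1 := by
  have h := M.expect_initial π (H := H) fun _ => 1
  simp only [expect, mul_one] at h
  rw [h, M.μ_mem.2]

/-- One step of the dynamics under `π`, acting on functions of the state. -/
def step (g : S → ℝ) (s : S) : ℝ := ∑ a, π.prob s a * ∑ s', M.P s a s' * g s'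

/-- Backward induction: integrating out the last step turns `g` into `M.step π g`. -/
theorem expect_trunc_mul_last {k H : ℕ} (hk : k ≤ H) (F : Traj S A k → ℝ) (g : S → ℝ) :
    expect (M.law π) (fun τ : Traj S A H => F (τ.trunc hk) * g (τ.1 (Fin.last H))) =
      expect (M.law π) fun σ => F σ * (M.step π)^[H - k] g (σ.1 (Fin.last k)) := by
  induction H, hk using Nat.le_induction generalizing g with
  | base => simp [Traj.trunc_self]
  | succ n hn ih =>
    rw [Nat.succ_sub hn, Function.iterate_succ_apply, ← ih, expect_succ]
    refine expect_congr fun σ _ => ?_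
    simp only [Traj.trunc_snoc hn, Traj.snoc_last, step, Finset.mul_sum]
    exact Finset.sum_congr rfl fun _ _ => Finset.sum_congr rfl fun _ _ => by ring

theorem stateValue_eq_iterate (R : S → ℝ) (h : ℕ) (s : S) :
    M.stateValue π R h s = (M.step π)^[h] R s := by
  classical
  have := (M.startAt s).expect_trunc_mul_last π h.zero_le (fun _ => 1) R
  simp only [one_mul, Nat.sub_zero] at this
  rw [stateValue, value, this]
  refine ((M.startAt s).expect_zero π _ ((M.step π)^[h] R) fun _ => rfl).trans ?_
  simp [startAt, Pi.single_apply]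

/-- The tower property: the terminal reward may be replaced by the value of an earlier state. -/
theorem expect_mul_reward {k H : ℕ} (hk : k ≤ H) (F : Traj S A k → ℝ) (R : S → ℝ) :
    expect (M.law π) (fun τ : Traj S A H => F (τ.trunc hk) * R (τ.1 (Fin.last H))) =
      expect (M.law π) fun τ : Traj S A H => F (τ.trunc hk) *
        M.stateValue π R (H - k) (τ.1 (Fin.castLE (Nat.succ_le_succ hk) (Fin.last k))) := by
  rw [expect_trunc_mul_last, ← M.expect_trunc π hk]
  simp only [stateValue_eq_iterate]
  rfl

/-- The Markov property: given the first `i + 1` state-action pairs, the next state is distributed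
according to the transition probabilities. -/
theorem expect_next {H : ℕ} (i : Fin H) (F : Traj S A H → S → ℝ)
    (hF : ∀ τ τ', SameHistory i.succ τ τ' → F τ' = F τ) :
    expect (M.law π) (fun τ => F τ (τ.1 i.succ)) =
      expect (M.law π) fun τ => ∑ s, M.P (τ.1 i.castSucc) (τ.2 i) s * F τ s := by
  rcases isEmpty_or_nonempty (Traj S A H) with _ | ⟨⟨τ₀⟩⟩
  · simp [expect]
  obtain ⟨n, hn⟩ := i
  have hn' : n + 1 ≤ H := hn
  -- Padding with an arbitrary `τ₀` makes `F` a function of the truncation, since `F` reads only the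
  -- history.
  let ext (σ : Traj S A (n + 1)) : Traj S A H :=
    (fun j => if h : (j : ℕ) < n + 2 then σ.1 ⟨j, h⟩ else τ₀.1 j,
      fun j => if h : (j : ℕ) < n + 1 then σ.2 ⟨j, h⟩ else τ₀.2 j)
  have hext (τ : Traj S A H) : F τ = F (ext (τ.trunc hn')) := by
    refine hF _ _ fun j hj => ?_
    have hj' : (j : ℕ) < n + 1 := hj
    constructor
    · simp only [ext, Fin.val_castSucc, dif_pos (Nat.lt_succ_of_lt hj')]
      rfl
    · simp only [ext, dif_pos hj']
      rfl
  -- The truncation to `n + 1` steps carries one state beyond the history; `F` ignores it.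
  have hsnoc (σ : Traj S A n) (a : A) (s s' : S) : F (ext (σ.snoc a s)) = F (ext (σ.snoc a s')) := by
    refine hF _ _ fun j hj => ?_
    have hj' : (j : ℕ) < n + 1 := hj
    constructor
    · simp only [ext, Fin.val_castSucc, dif_pos (Nat.lt_succ_of_lt hj')]
      have h (s) := Traj.snoc_castSucc σ a s ⟨j, hj'⟩
      exact (h s).trans (h s').symm
    · simp only [ext, dif_pos hj']
      rfl
  have hL := M.expect_trunc π hn' fun σ => F (ext σ) (σ.1 (Fin.last _))
  have hR := M.expect_trunc π hn' fun σ =>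
    ∑ s, M.P (σ.1 (Fin.last n).castSucc) (σ.2 (Fin.last n)) s * F (ext σ) s
  simp only [← hext] at hL hR
  refine hL.trans (Eq.trans ?_ hR.symm)
  rw [expect_succ, expect_succ]
  refine expect_congr fun σ _ => Finset.sum_congr rfl fun a _ => ?_
  congr 1
  simp only [Traj.snoc_last, Traj.snoc_castSucc, Traj.snoc_action_last]
  have h (s : S) : ∑ s', M.P (σ.1 (Fin.last n)) a s' * F (ext (σ.snoc a s)) s' =
      ∑ s', M.P (σ.1 (Fin.last n)) a s' * F (ext (σ.snoc a s')) s' :=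
    Finset.sum_congr rfl fun s' _ => by rw [hsnoc σ a s s']
  simp only [h, ← Finset.sum_mul, M.sum_P, one_mul]

end MDP

open Filter Topology

omit [Fintype S] [Fintype A] in
theorem SameHistory.congr {H : ℕ} {k : Fin (H + 1)} {τ σ σ' : Traj S A H}
    (h : SameHistory k σ σ') : SameHistory k τ σ ↔ SameHistory k τ σ' := by
  refine forall₂_congr fun i hi => ?_
  rw [(h i hi).1, (h i hi).2]

/-! ### Transition graph, DAG property and occupancies -/

namespace MDP

variable (M : MDP S A) (π : Policy S A)

theorem SameGraph.law_pos_iff {M M' : MDP S A} (h : M.SameGraph M') {H : ℕ} (τ : Traj S A H) :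
    0 < M.law π τ ↔ 0 < M'.law π τ := by
  simp only [MDP.law_pos_iff, h.1, h.2]

/-- The DAG property only depends on which trajectories have positive probability. This keeps the
perturbed MDPs in the family where `f` is unbiased. -/
theorem SameGraph.isDAG {M M' : MDP S A} (h : M.SameGraph M') {H : ℕ} (hM : M.IsDAG H) :
    M'.IsDAG H := by
  have hlaw (π : Policy S A) (τ : Traj S A H) := h.law_pos_iff π τ
  unfold IsDAG at hM ⊢
  simpa only [prob_pos_iff (MDP.law_nonneg _ _), hlaw] using hM

/-- A state that a stochastic policy visits with positive probability is visited at the same time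
with positive probability by a deterministic policy. -/
theorem IsDAG.exists_reaches {M : MDP S A} {H : ℕ} (hM : M.IsDAG H) {π : Policy S A}
    {τ : Traj S A H} (hτ : 0 < M.law π τ) (t : Fin (H + 1)) :
    ∃ g : S → A, 0 < prob (M.law (Policy.ofFun g)) fun τ' : Traj S A H => τ'.1 t = τ.1 t := by
  classical
  obtain ⟨n, hn⟩ := t
  induction n using Nat.strong_induction_on with
  | _ n ih =>
  have hnH : n ≤ H := Nat.lt_succ_iff.1 hn
  -- By induction the earlier states of `τ` are reached deterministically at their own times, so
  -- uniqueness of the time makes them distinct. A single function `g` can then imitate all the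
  -- earlier actions of `τ`.
  have hinj (i j : Fin n) (h : τ.1 (Fin.castLE hnH i).castSucc = τ.1 (Fin.castLE hnH j).castSucc) :
      i = j := by
    have hi := ih i i.2 (i.2.trans hn)
    have hj := ih j j.2 (j.2.trans hn)
    have := (hM (τ.1 (Fin.castLE hnH i).castSucc)).unique hi (h ▸ hj)
    exact Fin.ext (Fin.mk.inj this)
  obtain ⟨hμ, hP⟩ := (M.law_pos_iff π τ).1 hτ
  let g (s : S) : A :=
    if h : ∃ i : Fin n, τ.1 (Fin.castLE hnH i).castSucc = s then τ.2 (Fin.castLE hnH h.choose)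
    else Classical.choice (by
      by_contra hA
      rw [not_nonempty_iff] at hA
      simpa using (π.prob_mem s).2)
  have hg (i : Fin n) : g (τ.1 (Fin.castLE hnH i).castSucc) = τ.2 (Fin.castLE hnH i) := by
    have h : ∃ j : Fin n, τ.1 (Fin.castLE hnH j).castSucc = τ.1 (Fin.castLE hnH i).castSucc :=
      ⟨i, rfl⟩
    simp only [g, dif_pos h]
    rw [hinj _ _ h.choose_spec]
  refine ⟨g, ?_⟩
  have hpos : 0 < M.law (Policy.ofFun g) (τ.trunc hnH) := by
    rw [MDP.law_pos_iff]
    refine ⟨hμ, fun i => ⟨?_, (hP (Fin.castLE hnH i)).2⟩⟩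
    have := hg i
    change 0 < (Pi.single (g (τ.1 (Fin.castLE hnH i).castSucc)) 1 : A → ℝ) (τ.2 (Fin.castLE hnH i))
    rw [this, Pi.single_eq_same]
    exact one_pos
  rw [prob_eq_expect]
  refine lt_of_lt_of_eq ?_ (M.expect_trunc (Policy.ofFun g) hnH fun σ =>
    if σ.1 (Fin.last n) = τ.1 ⟨n, hn⟩ then 1 else 0).symm
  rw [← prob_eq_expect, prob_pos_iff (M.law_nonneg _)]
  exact ⟨_, rfl, hpos⟩

theorem occupancy_nonneg {H : ℕ} (i : Fin H) (s : S) (a : A) : 0 ≤ M.occupancy π i s a :=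
  Finset.sum_nonneg fun τ _ => M.law_nonneg π τ

theorem occupancy_pos {H : ℕ} {τ : Traj S A H} (hτ : M.law π τ ≠ 0) (i : Fin H) :
    0 < M.occupancy π i (τ.1 i.castSucc) (τ.2 i) :=
  (prob_pos_iff (M.law_nonneg π) _).2 ⟨τ, ⟨rfl, rfl⟩, (M.law_nonneg π τ).lt_of_ne' hτ⟩

/-- In a discrete DAG MDP, all policies can only visit a state at the same time. -/
theorem IsDAG.eq_of_occupancy_ne_zero {M : MDP S A} {H : ℕ} (hM : M.IsDAG H) {π π' : Policy S A}
    {i j : Fin H} {s : S} {a : A} (hi : M.occupancy π i s a ≠ 0) (hj : M.occupancy π' j s a ≠ 0) :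
    i = j := by
  obtain ⟨τ, ⟨rfl, -⟩, hτ⟩ := (prob_pos_iff (M.law_nonneg π) _).1
    ((M.occupancy_nonneg π i s a).lt_of_ne' hi)
  obtain ⟨τ', ⟨h, -⟩, hτ'⟩ := (prob_pos_iff (M.law_nonneg π') _).1
    ((M.occupancy_nonneg π' j _ a).lt_of_ne' hj)
  exact Fin.castSucc_injective _ ((hM _).unique (hM.exists_reaches hτ i.castSucc)
    (h ▸ hM.exists_reaches hτ' j.castSucc))

theorem expect_eq_sum_occupancy {H : ℕ} (i : Fin H) (φ : S → A → ℝ) :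
    expect (M.law π) (fun τ => φ (τ.1 i.castSucc) (τ.2 i)) =
      ∑ s, ∑ a, M.occupancy π i s a * φ s a := by
  classical
  have h (s : S) (a : A) : M.occupancy π i s a * φ s a = expect (M.law π) fun τ =>
      if τ.1 i.castSucc = s then if τ.2 i = a then φ s a else 0 else 0 := by
    simp only [occupancy, prob_eq_expect, expect, Finset.sum_mul]
    exact Finset.sum_congr rfl fun τ _ => by split_ifs <;> simp_all
  simp only [h, ← expect_sum]
  simp

/-- Given the first `i + 1` state-action pairs, the next state has the variance of the transition
probabilities. -/
theorem condVariance_sameHistory_succ {H : ℕ} (i : Fin H) {τ : Traj S A H} (hτ : M.law π τ ≠ 0)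
    (g : S → ℝ) :
    condVariance (M.law π) (SameHistory i.succ τ) (fun τ' => g (τ'.1 i.succ)) =
      ∑ s, M.P (τ.1 i.castSucc) (τ.2 i) s *
        (g s - ∑ s', M.P (τ.1 i.castSucc) (τ.2 i) s' * g s') ^ 2 := by
  classical
  -- Stated for every `g`: it is applied to the mean and then to the squared deviation.
  have key (g : S → ℝ) : condExpect (M.law π) (SameHistory i.succ τ) (fun τ' => g (τ'.1 i.succ)) =
      ∑ s, M.P (τ.1 i.castSucc) (τ.2 i) s * g s := by
    refine condExpect_eq_of_expect_eq ((prob_pos_iff (M.law_nonneg π) _).2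
      ⟨τ, fun _ _ => ⟨rfl, rfl⟩, (M.law_nonneg π τ).lt_of_ne' hτ⟩).ne' ?_
    rw [M.expect_next π i (fun τ' s => if SameHistory i.succ τ τ' then g s else 0)
      fun σ σ' h => by simp only [h.congr]]
    refine expect_congr fun τ' _ => ?_
    split_ifs with h
    · have := h i (Nat.lt_succ_self _)
      rw [this.1, this.2]
    · simp
  unfold condVariance
  rw [key g]
  exact key fun s => (g s - ∑ s', M.P (τ.1 i.castSucc) (τ.2 i) s' * g s') ^ 2

theorem condVariance_sameHistory_zero {H : ℕ} (τ : Traj S A H) (g : S → ℝ) :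
    condVariance (M.law π) (SameHistory 0 τ) (fun τ' => g (τ'.1 0)) =
      ∑ s, M.μ s * (g s - ∑ s', M.μ s' * g s') ^ 2 := by
  classical
  have hC (τ' : Traj S A H) : SameHistory 0 τ τ' := fun _ h => absurd h (Nat.not_lt_zero _)
  have key (g : S → ℝ) : condExpect (M.law π) (SameHistory 0 τ) (fun τ' => g (τ'.1 0)) =
      ∑ s, M.μ s * g s := by
    have h₁ : prob (M.law π) (SameHistory 0 τ) = 1 := by simp [prob, hC, M.sum_law π]
    rw [← M.expect_initial π (H := H) g]
    simp [condExpect, h₁, hC, expect]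
  unfold condVariance
  rw [key g]
  exact key fun s => (g s - ∑ s', M.μ s' * g s') ^ 2

/-! ### Perturbed parameters and the score identity -/

/-- The derivative in direction `(d₀, d)` of the logarithm of the law of the trajectory. -/
def score (d₀ : S → ℝ) (d : S → A → S → ℝ) {H : ℕ} (τ : Traj S A H) : ℝ :=
  d₀ (τ.1 0) + ∑ i : Fin H, d (τ.1 i.castSucc) (τ.2 i) (τ.1 i.succ)

/-- The parameters of `M` moved by `ε` in direction `(d₀, d)`. -/
def perturb (d₀ : S → ℝ) (d : S → A → S → ℝ) (hd₀ : ∑ s, M.μ s * d₀ s = 0)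
    (hd : ∀ s a, ∑ s', M.P s a s' * d s a s' = 0) (ε : ℝ) (h₀ : ∀ s, 0 < 1 + ε * d₀ s)
    (h : ∀ s a s', 0 < 1 + ε * d s a s') : MDP S A where
  μ s := M.μ s * (1 + ε * d₀ s)
  P s a s' := M.P s a s' * (1 + ε * d s a s')
  μ_mem := by
    refine ⟨fun s => mul_nonneg (M.μ_mem.1 s) (h₀ s).le, ?_⟩
    simp only [mul_add, mul_one, Finset.sum_add_distrib, mul_left_comm _ ε, ← Finset.mul_sum, hd₀,
      M.μ_mem.2, mul_zero, add_zero]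
  P_mem s a := by
    refine ⟨fun s' => mul_nonneg ((M.P_mem s a).1 s') (h s a s').le, ?_⟩
    simp only [mul_add, mul_one, Finset.sum_add_distrib, mul_left_comm _ ε, ← Finset.mul_sum, hd,
      M.sum_P, mul_zero, add_zero]

/-- At `ε = 0` every factor is `1`, so the product rule leaves the sum of the slopes. The polynomial
in `ε` makes sense for all `ε`, whereas `perturb` needs positive factors. -/
theorem hasDerivAt_expect_perturb (d₀ : S → ℝ) (d : S → A → S → ℝ) {H : ℕ} (X : Traj S A H → ℝ) :
    HasDerivAt (fun ε : ℝ => ∑ τ, M.law π τ * ((1 + ε * d₀ (τ.1 0)) *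
        ∏ i : Fin H, (1 + ε * d (τ.1 i.castSucc) (τ.2 i) (τ.1 i.succ))) * X τ)
      (expect (M.law π) fun τ => X τ * score d₀ d τ) 0 := by
  have hlin (c : ℝ) : HasDerivAt (fun ε : ℝ => 1 + ε * c) c 0 := by
    simpa using ((hasDerivAt_id (0 : ℝ)).mul_const c).const_add 1
  refine HasDerivAt.fun_sum fun τ _ => ?_
  have hprod := HasDerivAt.fun_finsetProd (u := Finset.univ) fun i (_ : i ∈ Finset.univ) =>
    hlin (d (τ.1 (Fin.castSucc i)) (τ.2 i) (τ.1 (Fin.succ i)))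
  refine ((((hlin (d₀ (τ.1 0))).fun_mul hprod).const_mul (M.law π τ)).mul_const
    (X τ)).congr_deriv ?_
  simp [score]
  ring

/-- Differentiating the unbiasedness relation along a perturbation of the parameters. -/
theorem expect_mul_score_eq {M : MDP S A} {H : ℕ} (hM : M.IsDAG H) {π₀ π₁ : Policy S A} {R : S → ℝ}
    {f : Traj S A H → ℝ} (hf : IsUnbiased M π₀ π₁ R f) (d₀ : S → ℝ) (d : S → A → S → ℝ)
    (hd₀ : ∑ s, M.μ s * d₀ s = 0) (hd : ∀ s a, ∑ s', M.P s a s' * d s a s' = 0) :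
    expect (M.law π₀) (fun τ => f τ * score d₀ d τ) =
      expect (M.law π₁) fun τ => R (τ.1 (Fin.last H)) * score d₀ d τ := by
  -- Unbiasedness makes the two polynomials agree for `ε` near `0`; their derivatives there
  -- coincide.
  refine (M.hasDerivAt_expect_perturb π₀ d₀ d f).unique
    ((M.hasDerivAt_expect_perturb π₁ d₀ d fun τ => R (τ.1 (Fin.last H))).congr_of_eventuallyEq ?_)
  have hev (c : ℝ) : ∀ᶠ ε : ℝ in 𝓝 0, 0 < 1 + ε * c := by
    have : ContinuousAt (fun ε : ℝ => 1 + ε * c) 0 := by fun_prop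
    exact this.eventually (lt_mem_nhds (by simp))
  have hev₀ : ∀ᶠ ε : ℝ in 𝓝 0, ∀ s, 0 < 1 + ε * d₀ s := eventually_all.2 fun s => hev _
  have hev₁ : ∀ᶠ ε : ℝ in 𝓝 0, ∀ s a s', 0 < 1 + ε * d s a s' :=
    eventually_all.2 fun s => eventually_all.2 fun a => eventually_all.2 fun s' => hev _
  filter_upwards [hev₀, hev₁] with ε h₀ h₁
  have hlaw (π : Policy S A) (τ : Traj S A H) :
      (M.perturb d₀ d hd₀ hd ε h₀ h₁).law π τ = M.law π τ * ((1 + ε * d₀ (τ.1 0)) *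
        ∏ i : Fin H, (1 + ε * d (τ.1 i.castSucc) (τ.2 i) (τ.1 i.succ))) := by
    simp only [law, perturb, ← mul_assoc, Finset.prod_mul_distrib]
    ring
  have hG : M.SameGraph (M.perturb d₀ d hd₀ hd ε h₀ h₁) :=
    ⟨fun s => (mul_pos_iff_of_pos_right (h₀ s)).symm,
      fun s a s' => (mul_pos_iff_of_pos_right (h₁ s a s')).symm⟩
  have := hf _ (hG.isDAG hM) hG
  simp only [value, expect, hlaw] at this
  exact this

end MDP

/-! ### Martingale differences and the optimal direction -/

theorem sum_mul_sub_mean {p : S → ℝ} (hp : ∑ s, p s = 1) (g : S → ℝ) :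
    ∑ s, p s * (g s - ∑ s', p s' * g s') = 0 := by
  simp only [mul_sub, Finset.sum_sub_distrib, ← Finset.sum_mul, hp, one_mul, sub_self]

theorem sum_mul_sub_mean_mul {p : S → ℝ} (hp : ∑ s, p s = 1) (g : S → ℝ) :
    ∑ s, p s * ((g s - ∑ s', p s' * g s') * g s) = ∑ s, p s * (g s - ∑ s', p s' * g s') ^ 2 := by
  have h := congrArg (· * ∑ s', p s' * g s') (sum_mul_sub_mean hp g)
  simp only [zero_mul] at h
  generalize ∑ s', p s' * g s' = m at h ⊢
  rw [Finset.sum_mul] at h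
  rw [← sub_eq_zero, ← h, ← Finset.sum_sub_distrib]
  exact Finset.sum_congr rfl fun s _ => by ring

namespace MDP

variable (M : MDP S A) (π π₀ π₁ : Policy S A) (R : S → ℝ) (H : ℕ)

/-- The value under `π₁` of the initial state, minus its mean. -/
noncomputable def initialIncrement (s : S) : ℝ :=
  M.stateValue π₁ R H s - ∑ s', M.μ s' * M.stateValue π₁ R H s'

variable {H}

/-- The value under `π₁` of the state following the pair `(s, a)` at time `i`, minus its mean. -/
noncomputable def valueIncrement (i : Fin H) (s : S) (a : A) (s' : S) : ℝ :=
  M.stateValue π₁ R (H - i.succ) s' - ∑ x, M.P s a x * M.stateValue π₁ R (H - i.succ) x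

/-- The ratio of the probabilities of the pair `(s, a)` at time `i` under `π₁` and `π₀`. -/
noncomputable def pairRatio (i : Fin H) (s : S) (a : A) : ℝ := M.occupancy π₁ i s a / M.occupancy π₀ i s a

/-- The variance of the value under `π₁` of the state following `(s, a)` at time `i`. -/
noncomputable def valueVariance (i : Fin H) (s : S) (a : A) : ℝ :=
  ∑ s', M.P s a s' * M.valueIncrement π₁ R i s a s' ^ 2

/-- The `k`-th martingale difference of the optimal estimator. -/
noncomputable def increment (k : Fin (H + 1)) (τ : Traj S A H) : ℝ :=
  Fin.cases (M.initialIncrement π₁ R H (τ.1 0))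
    (fun i => M.pairRatio π₀ π₁ i (τ.1 i.castSucc) (τ.2 i) *
      M.valueIncrement π₁ R i (τ.1 i.castSucc) (τ.2 i) (τ.1 i.succ)) k

/-- Given the history, the ratio is fixed and the value increment has mean zero. -/
theorem expect_mul_increment_succ (i : Fin H) (F : Traj S A H → ℝ)
    (hF : ∀ τ τ', SameHistory i.succ τ τ' → F τ' = F τ) :
    expect (M.law π) (fun τ => F τ * M.increment π₀ π₁ R i.succ τ) = 0 := by
  refine (M.expect_next π i (fun τ s => F τ * (M.pairRatio π₀ π₁ i (τ.1 i.castSucc) (τ.2 i) *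
      M.valueIncrement π₁ R i (τ.1 i.castSucc) (τ.2 i) s)) fun τ τ' h => ?_).trans ?_
  · rw [hF τ τ' h, (h i (Nat.lt_succ_self _)).1, (h i (Nat.lt_succ_self _)).2]
  · refine Finset.sum_eq_zero fun τ _ => ?_
    have := sum_mul_sub_mean (M.sum_P (τ.1 i.castSucc) (τ.2 i)) (M.stateValue π₁ R (H - i.succ))
    simp only [mul_left_comm (M.P _ _ _), ← Finset.mul_sum, valueIncrement, this, mul_zero]

theorem increment_eq_of_sameHistory {j : Fin (H + 1)} {i : Fin H} (hj : j < i.succ)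
    {τ τ' : Traj S A H} (h : SameHistory i.succ τ τ') :
    M.increment π₀ π₁ R j τ' = M.increment π₀ π₁ R j τ := by
  cases j using Fin.cases with
  | zero =>
    have h0 := (h ⟨0, i.pos⟩ (Nat.succ_pos _)).1
    exact congrArg (M.initialIncrement π₁ R H) h0
  | succ j =>
    have hji : j < i := Fin.succ_lt_succ_iff.1 hj
    have h1 := h j (hj : (j.succ : ℕ) < i.succ).le
    -- The state reached after pair `j` belongs to pair `j + 1 ≤ i`, hence to the history.
    have h2 := (h ⟨j + 1, lt_of_le_of_lt hji i.2⟩ (Nat.succ_lt_succ hji)).1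
    have h3 : τ'.1 j.succ = τ.1 j.succ := h2
    simp only [increment, Fin.cases_succ, h1.1, h1.2, h3]

theorem expect_increment (k : Fin (H + 1)) :
    expect (M.law π) (M.increment π₀ π₁ R k) = 0 := by
  cases k using Fin.cases with
  | zero =>
    exact (M.expect_initial π (M.initialIncrement π₁ R H)).trans
      (sum_mul_sub_mean M.μ_mem.2 _)
  | succ i => simpa using M.expect_mul_increment_succ π π₀ π₁ R i (fun _ => 1) fun _ _ _ => rfl

theorem expect_increment_mul_increment {j k : Fin (H + 1)} (h : j ≠ k) :
    expect (M.law π) (fun τ => M.increment π₀ π₁ R j τ * M.increment π₀ π₁ R k τ) = 0 := by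
  wlog hjk : j < k generalizing j k
  · simpa only [mul_comm] using this h.symm (h.lt_or_gt.resolve_left hjk)
  obtain ⟨i, rfl⟩ := Fin.exists_succ_eq.2 (Fin.ne_zero_of_lt hjk)
  exact M.expect_mul_increment_succ π π₀ π₁ R i _
    fun _ _ => M.increment_eq_of_sameHistory π₀ π₁ R hjk

theorem expect_sum_increment_sq :
    expect (M.law π) (fun τ : Traj S A H => (∑ k, M.increment π₀ π₁ R k τ) ^ 2) =
      ∑ k, expect (M.law π) fun τ : Traj S A H => M.increment π₀ π₁ R k τ ^ 2 := by
  simp only [sq, Finset.sum_mul_sum, expect_sum]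
  refine Finset.sum_congr rfl fun k _ => ?_
  exact Finset.sum_eq_single k (fun j _ hj => M.expect_increment_mul_increment π π₀ π₁ R hj.symm)
    (by simp)

theorem expect_increment_zero_sq :
    expect (M.law π) (fun τ : Traj S A H => M.increment π₀ π₁ R 0 τ ^ 2) =
      ∑ s, M.μ s * M.initialIncrement π₁ R H s ^ 2 :=
  M.expect_initial π fun s => M.initialIncrement π₁ R H s ^ 2

theorem expect_increment_succ_sq (i : Fin H) :
    expect (M.law π) (fun τ => M.increment π₀ π₁ R i.succ τ ^ 2) =
      expect (M.law π) fun τ => M.pairRatio π₀ π₁ i (τ.1 i.castSucc) (τ.2 i) ^ 2 *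
        M.valueVariance π₁ R i (τ.1 i.castSucc) (τ.2 i) := by
  refine (M.expect_next π i (fun τ s => (M.pairRatio π₀ π₁ i (τ.1 i.castSucc) (τ.2 i) *
      M.valueIncrement π₁ R i (τ.1 i.castSucc) (τ.2 i) s) ^ 2) fun τ τ' h => ?_).trans ?_
  · rw [(h i (Nat.lt_succ_self _)).1, (h i (Nat.lt_succ_self _)).2]
  · refine expect_congr fun τ _ => ?_
    simp only [valueVariance, Finset.mul_sum]
    exact Finset.sum_congr rfl fun s _ => by ring

theorem expect_reward_mul_increment_zero :
    expect (M.law π₁) (fun τ : Traj S A H => R (τ.1 (Fin.last H)) * M.increment π₀ π₁ R 0 τ) =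
      ∑ s, M.μ s * M.initialIncrement π₁ R H s ^ 2 := by
  have h := M.expect_mul_reward π₁ H.zero_le
    (fun σ => M.initialIncrement π₁ R H (σ.1 0)) R
  have h' := M.expect_initial π₁ (H := H) fun s =>
    M.initialIncrement π₁ R H s * M.stateValue π₁ R H s
  simp only [mul_comm (R _)]
  exact h.trans (h'.trans (sum_mul_sub_mean_mul M.μ_mem.2 _))

/-- The tower property under `π₁` replaces the reward by the next value `V`, and E[(V - E V) V] is
the variance of `V`. -/
theorem expect_reward_mul_increment_succ (i : Fin H) :
    expect (M.law π₁) (fun τ => R (τ.1 (Fin.last H)) * M.increment π₀ π₁ R i.succ τ) =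
      expect (M.law π₁) fun τ => M.pairRatio π₀ π₁ i (τ.1 i.castSucc) (τ.2 i) *
        M.valueVariance π₁ R i (τ.1 i.castSucc) (τ.2 i) := by
  have h := M.expect_mul_reward π₁ (Nat.succ_le_of_lt i.2) (fun σ : Traj S A (i + 1) =>
    M.pairRatio π₀ π₁ i (σ.1 (Fin.last i).castSucc) (σ.2 (Fin.last i)) *
      M.valueIncrement π₁ R i (σ.1 (Fin.last i).castSucc) (σ.2 (Fin.last i))
        (σ.1 (Fin.last i).succ)) R
  simp only [mul_comm (R _)]
  refine h.trans ((M.expect_next π₁ i (fun τ s =>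
    M.pairRatio π₀ π₁ i (τ.1 i.castSucc) (τ.2 i) *
      M.valueIncrement π₁ R i (τ.1 i.castSucc) (τ.2 i) s * M.stateValue π₁ R (H - i.succ) s)
      fun τ τ' h => ?_).trans ?_)
  · rw [(h i (Nat.lt_succ_self _)).1, (h i (Nat.lt_succ_self _)).2]
  · refine expect_congr fun τ _ => ?_
    have := sum_mul_sub_mean_mul (M.sum_P (τ.1 i.castSucc) (τ.2 i))
      (M.stateValue π₁ R (H - i.succ))
    simp only [valueVariance, valueIncrement]
    rw [← this, Finset.mul_sum]
    exact Finset.sum_congr rfl fun s _ => by ring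

/-- Both sides weight the variance after `(s, a)` by `P₁(s, a)² / P₀(s, a)`. -/
theorem expect_pairRatio_mul (i : Fin H) (φ : S → A → ℝ) :
    expect (M.law π₁) (fun τ => M.pairRatio π₀ π₁ i (τ.1 i.castSucc) (τ.2 i) *
        φ (τ.1 i.castSucc) (τ.2 i)) =
      expect (M.law π₀) fun τ => M.pairRatio π₀ π₁ i (τ.1 i.castSucc) (τ.2 i) ^ 2 *
        φ (τ.1 i.castSucc) (τ.2 i) := by
  rw [M.expect_eq_sum_occupancy π₁ i fun s a => M.pairRatio π₀ π₁ i s a * φ s a,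
    M.expect_eq_sum_occupancy π₀ i fun s a => M.pairRatio π₀ π₁ i s a ^ 2 * φ s a]
  refine Finset.sum_congr rfl fun s _ => Finset.sum_congr rfl fun a _ => ?_
  -- Here division by zero sets `pairRatio` to `0` and both terms vanish, so `π₁` may visit pairs
  -- that `π₀` never visits.
  by_cases h : M.occupancy π₀ i s a = 0
  · simp [pairRatio, h]
  · simp only [pairRatio]
    field_simp

theorem expect_reward_mul_increment (k : Fin (H + 1)) :
    expect (M.law π₁) (fun τ => R (τ.1 (Fin.last H)) * M.increment π₀ π₁ R k τ) =
      expect (M.law π₀) fun τ => M.increment π₀ π₁ R k τ ^ 2 := by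
  cases k using Fin.cases with
  | zero => rw [expect_reward_mul_increment_zero, expect_increment_zero_sq]
  | succ i =>
    rw [expect_reward_mul_increment_succ, expect_increment_succ_sq, expect_pairRatio_mul]

theorem expect_occupancyRatio_sq_mul_condVarValue (k : Fin (H + 1)) :
    expect (M.law π₀) (fun τ => M.occupancyRatio π₀ π₁ k τ ^ 2 * M.condVarValue π₀ π₁ R k τ) =
      expect (M.law π₀) fun τ => M.increment π₀ π₁ R k τ ^ 2 := by
  cases k using Fin.cases with
  | zero =>
    simp only [expect_increment_zero_sq, condVarValue]
    have h (τ : Traj S A H) := M.condVariance_sameHistory_zero π₀ τ (M.stateValue π₁ R H)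
    refine (expect_congr (Y := fun _ => ∑ s, M.μ s * M.initialIncrement π₁ R H s ^ 2)
      fun τ _ => ?_).trans ?_
    · simp only [occupancyRatio, Fin.cases_zero, one_pow, one_mul]
      exact h τ
    · simp only [expect, ← Finset.sum_mul, M.sum_law, one_mul]
  | succ i =>
    rw [expect_increment_succ_sq]
    refine expect_congr fun τ hτ => ?_
    rw [condVarValue, M.condVariance_sameHistory_succ π₀ i hτ]
    rfl

/-- The perturbation of the transition probabilities whose score is the sum of the increments. -/
noncomputable def direction (s : S) (a : A) (s' : S) : ℝ :=
  ∑ i : Fin H, M.pairRatio π₀ π₁ i s a * M.valueIncrement π₁ R i s a s'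

theorem sum_P_mul_direction (s : S) (a : A) :
    ∑ s', M.P s a s' * M.direction π₀ π₁ R (H := H) s a s' = 0 := by
  simp only [direction, Finset.mul_sum]
  rw [Finset.sum_comm]
  refine Finset.sum_eq_zero fun i _ => ?_
  have := sum_mul_sub_mean (M.sum_P s a) (M.stateValue π₁ R (H - i.succ))
  simp only [mul_left_comm (M.P _ _ _), ← Finset.mul_sum, valueIncrement, this, mul_zero]

/-- `direction` sums over all times because transition probabilities are stationary. A pair met at
time `i` has zero `π₁`-occupancy at every other time, so only the `i`-th term survives. -/
theorem IsDAG.score_eq_sum_increment {M : MDP S A} (hM : M.IsDAG H) {π : Policy S A}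
    {τ : Traj S A H} (hτ : M.law π τ ≠ 0) :
    score (M.initialIncrement π₁ R H) (M.direction π₀ π₁ R (H := H)) τ =
      ∑ k, M.increment π₀ π₁ R k τ := by
  rw [Fin.sum_univ_succ]
  refine congrArg₂ _ rfl (Finset.sum_congr rfl fun i _ => ?_)
  refine Finset.sum_eq_single i (fun j _ hj => ?_) (by simp)
  have : M.occupancy π₁ j (τ.1 i.castSucc) (τ.2 i) = 0 := by
    by_contra h
    exact hj (hM.eq_of_occupancy_ne_zero h (M.occupancy_pos π hτ i).ne')
  simp [pairRatio, this]

end MDP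

end DagMDP

theorem theorem3 {S A : Type*} [Fintype S] [Fintype A] (H : ℕ)
    (M : DagMDP.MDP S A) (hM : M.IsDAG H) (R : S → ℝ) (π₀ π₁ : DagMDP.Policy S A)
    (f : DagMDP.Traj S A H → ℝ) (hf : DagMDP.IsUnbiased M π₀ π₁ R f) :
    ∑ k : Fin (H + 1), DagMDP.expect (M.law π₀)
        (fun τ => M.occupancyRatio π₀ π₁ k τ ^ 2 * M.condVarValue π₀ π₁ R k τ)
      ≤ DagMDP.variance (M.law π₀) f := by
  simp only [M.expect_occupancyRatio_sq_mul_condVarValue]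
  rw [← M.expect_sum_increment_sq π₀ π₀ π₁ R]
  refine DagMDP.expect_sq_le_variance (M.law_nonneg π₀) ?_ ?_
  · rw [DagMDP.expect_sum]
    exact Finset.sum_eq_zero fun k _ => M.expect_increment π₀ π₀ π₁ R k
  · have h := DagMDP.MDP.expect_mul_score_eq hM hf (M.initialIncrement π₁ R H)
      (M.direction π₀ π₁ R (H := H)) (DagMDP.sum_mul_sub_mean M.μ_mem.2 _)
      (M.sum_P_mul_direction π₀ π₁ R)
    -- Score and sum of increments are only known to agree on trajectories of positive probability,
    -- hence one rewrite for each of the two laws.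
    rw [DagMDP.expect_congr fun τ hτ => by rw [hM.score_eq_sum_increment π₀ π₁ R hτ],
      DagMDP.expect_congr (p := M.law π₁) fun τ hτ => by
        rw [hM.score_eq_sum_increment π₀ π₁ R hτ]] at h
    rw [h, M.expect_sum_increment_sq]
    simp only [Finset.mul_sum, DagMDP.expect_sum, M.expect_reward_mul_increment]
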